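/- **Theorem (Strong direct sum theorem).** A deterministic decision tree over input bits $x_i\in\{\pm1\}$ ($i$ in a finite index set) has internal nodes that each query one $x_i$ and branch on its value, and leaves labeled by output values. A randomized decision tree $\mathcal T$ is a probability distribution over deterministic decision trees. For a distribution $\mu$ on the inputs, the expected depth of $\mathcal T$ is the expected number of queries made by $T\sim\mathcal T$ on $x\sim\mu$, and the error of $\mathcal T$ for a function $g$ is $\Pr_{T\sim\mathcal T,\,x\sim\mu}[T(x)\ne g(x)]$. Write $\overline{\mathrm{Depth}}^{\mu}(g,\varepsilon)\in[0,\infty]$ for the minimum expected depth under $\mu$ of a randomized decision tree whose error for $g$ under $\mu$ is at most $\varepsilon$ (it is $\infty$ if $\varepsilon<0$, as then there is no such tree). For $f:\{\pm1\}^n\to\{\pm1\}$ let $f^{\otimes k}(X^{(1)},\dots,X^{(k)})=(f(X^{(1)}),\dots,f(X^{(k)}))$, a function of $kn$ bits with outputs in $\{\pm1\}^k$, and let $\mu^k$ be the $k$-fold product of $\mu$. 1. There are universal constants $c_1,c_2>0$ such that for all $n\in\mathbb N$, all $f:\{\pm1\}^n\to\{\pm1\}$, all distributions $\mu$ on $\{\pm1\}^n$,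 all $k\in\mathbb N$ and all $\gamma,\delta\in(0,1)$, $$\overline{\mathrm{Depth}}^{\mu^k}\!\left(f^{\otimes k},\,1-e^{-c_1\delta k}-\gamma\right)\;\ge\; c_2\,\frac{\gamma^2k}{\log(1/\delta)}\cdot\overline{\mathrm{Depth}}^{\mu}(f,\delta).$$ 2. For every $\varepsilon_0\in(0,1)$ there are constants $C,c>0$, depending only on $\varepsilon_0$, such that for all $n$, $f$, $\mu$ as above, all integers $k\ge1$ and all $\varepsilon\in(0,\varepsilon_0]$, $$\overline{\mathrm{Depth}}^{\mu^k}(f^{\otimes k},\varepsilon)\;\ge\; c\,\frac{\varepsilon^2k}{\log(2k/\varepsilon)}\cdot\overline{\mathrm{Depth}}^{\mu}\!\left(f,\tfrac{C\varepsilon}{k}\right).$$ -/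

import Mathlib

open scoped ENNReal

noncomputable section

namespace QueryComplexity

/-- A deterministic decision tree over the input bits `x i`, `i : ι`, whose leaves are labeled by
elements of `β`. An internal node `node i l r` queries the coordinate `i`. -/
inductive DecisionTree (ι β : Type) : Type
  | leaf (b : β) : DecisionTree ι β
  | node (i : ι) (left right : DecisionTree ι β) : DecisionTree ι β

namespace DecisionTree

variable {ι β : Type}

/-- The output of a tree on `x ∈ {±1}^ι`: at a node that queries `i`, proceed to the left child
if `x i = -1` and to the right child if `x i = 1`. -/
def eval : DecisionTree ι β → (ι → ℤˣ) → β
  | leaf b, _ => b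
  | node i l r, x => if x i = -1 then l.eval x else r.eval x

/-- The number of queries a tree makes on the input `x`. -/
def queries : DecisionTree ι β → (ι → ℤˣ) → ℕ
  | leaf _, _ => 0
  | node i l r, x => (if x i = -1 then l.queries x else r.queries x) + 1

variable [Fintype ι] [DecidableEq ι] [DecidableEq β]

/-- Expected depth of a deterministic tree: its expected number of queries on `x ∼ μ`. -/
def expectedDepth (μ : PMF (ι → ℤˣ)) (T : DecisionTree ι β) : ℝ≥0∞ :=
  ∑ x, μ x * (T.queries x : ℝ≥0∞)

/-- Error of a deterministic tree: the probability over `x ∼ μ` that its output is not `g x`. -/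
def error (μ : PMF (ι → ℤˣ)) (g : (ι → ℤˣ) → β) (T : DecisionTree ι β) : ℝ≥0∞ :=
  ∑ x, μ x * (if T.eval x = g x then 0 else 1)

end DecisionTree

/-- A randomized decision tree is a probability distribution over deterministic decision trees. -/
abbrev RandomizedTree (ι β : Type) : Type := PMF (DecisionTree ι β)

namespace RandomizedTree

variable {ι β : Type} [Fintype ι] [DecidableEq ι] [DecidableEq β]

/-- Expected depth of a randomized tree, possibly `∞`. -/
def expectedDepth (μ : PMF (ι → ℤˣ)) (R : RandomizedTree ι β) : ℝ≥0∞ :=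
  ∑' T, R T * T.expectedDepth μ

/-- Error of a randomized tree: the probability over `T ∼ R` and `x ∼ μ` that `T x ≠ g x`. -/
def error (μ : PMF (ι → ℤˣ)) (g : (ι → ℤˣ) → β) (R : RandomizedTree ι β) : ℝ≥0∞ :=
  ∑' T, R T * T.error μ g

end RandomizedTree

/-- The error of a randomized tree is at most `1`, so its real value below is not a junk value. -/
theorem RandomizedTree.error_le_one {ι β : Type} [Fintype ι] [DecidableEq ι] [DecidableEq β]
    (μ : PMF (ι → ℤˣ)) (g : (ι → ℤˣ) → β) (R : RandomizedTree ι β) : R.error μ g ≤ 1 := by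
  have h1 (T : DecisionTree ι β) : T.error μ g ≤ 1 := by
    calc T.error μ g ≤ ∑ x, μ x := by
          refine Finset.sum_le_sum fun x _ => ?_
          split_ifs <;> simp
      _ = 1 := by rw [← tsum_fintype (L := .unconditional _)]; exact μ.tsum_coe
  calc R.error μ g ≤ ∑' T, R T :=
        ENNReal.tsum_le_tsum fun T => by simpa using mul_le_mul_right (h1 T) (R T)
    _ = 1 := R.tsum_coe

/-- `avgDepth μ g ε`: the minimum expected depth under `μ` of a (randomized) decision tree that
computes `g` to error at most `ε` under `μ`. It is `∞` if there is no such tree, as happens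
exactly when `ε < 0`. -/
def avgDepth {ι β : Type} [Fintype ι] [DecidableEq ι] [DecidableEq β]
    (μ : PMF (ι → ℤˣ)) (g : (ι → ℤˣ) → β) (ε : ℝ) : ℝ≥0∞ :=
  ⨅ (R : RandomizedTree ι β) (_ : (R.error μ g).toReal ≤ ε), R.expectedDepth μ

/-- The `j`-th block of `X ∈ ({±1}^n)^k`; an element of `({±1}^n)^k` is given by its `k * n` bits
`X (j, i)`. -/
def block {n k : ℕ} (X : Fin k × Fin n → ℤˣ) (j : Fin k) : Fin n → ℤˣ := fun i => X (j, i)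

/-- The `k`-fold direct product of `f`. -/
def directProduct {n : ℕ} (f : (Fin n → ℤˣ) → ℤˣ) (k : ℕ) (X : Fin k × Fin n → ℤˣ) :
    Fin k → ℤˣ := fun j => f (block X j)

/-- The `k`-fold product distribution `μ × ⋯ × μ` on `({±1}^n)^k`. -/
def productPMF {n : ℕ} (μ : PMF (Fin n → ℤˣ)) (k : ℕ) : PMF (Fin k × Fin n → ℤˣ) :=
  PMF.ofFintype (fun X => ∏ j, μ (block X j)) (by
    have h : ∑ x, μ x = 1 := by
      rw [← tsum_fintype (L := .unconditional _)]; exact μ.tsum_coe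
    rw [← (Equiv.curry (Fin k) (Fin n) ℤˣ).symm.sum_comp]
    have h2 := (Finset.prod_univ_sum (fun _ : Fin k => (Finset.univ : Finset (Fin n → ℤˣ)))
      (fun _ x => μ x)).symm
    simp only [h, Finset.prod_const_one, Fintype.piFinset_univ] at h2
    exact h2)

end QueryComplexity

end

/-! A hardcore measure turns the hardness of `f` into a product bound that holds at every leaf of a
tree for `f^{⊗k}`.

Hardcore measure (`exists_hardcore`). Suppose `f` needs expected depth above `t * d` for error `δ`.
Then there is `H` with values in [0,1], of density `s = δ/2` under `μ`, on which every tree of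
expected depth `q` has advantage at most `g * s * (1 + q / d)`. Otherwise, minimax gives one random
tree of expected depth at most `d` whose correlation with `f` exceeds `g` on average over every
measure of density `s`. Its pointwise correlation is then above `g` outside a set of mass below `s`,
and a majority of `t` copies has error at most `2 * s`.

Leaves (`accuracy_leaf_le`). The inputs that reach a leaf carry a product measure. If block `j` has
`H`-density `D j` and best constant advantage `A j` there, its answer is right with probability at
most `1 - (D j - A j) / 2`. So the leaf is right with probability at most `exp (∑ A j / 2 - ∑ D j /
2)`. Leaves with `∑ A j ≥ θ` are charged to the total advantage as in Markov's inequality. At the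
others Jensen replaces `exp (-D j / 2)` by the mean of `exp (-H / 2)`. These means sum over all
leaves to an expectation that no longer depends on the tree, so no concentration of leaf densities
is needed.

Total advantage (`advantage_block_le`). The tree relabeled to guess `f` on block `i` becomes, once
the other blocks are fixed, a single-block tree. The hardcore bound applies to it, and the queries
per block add up to all queries. With `θ = k * s / 4` and `g = γ / 8` this gives expected depth at
least `k * d`. The second statement is the first with `γ` of order `ε` and `δ` of order `ε / k`. -/

open scoped ENNReal

noncomputable section

namespace QueryComplexity

/-! ### Expectations and mixtures of discrete distributions. -/

/-- The expectation of a nonnegative function under a discrete distribution. -/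
def mean {α : Type} (p : PMF α) (F : α → ℝ≥0∞) : ℝ≥0∞ := ∑' a, p a * F a

section Mean

variable {α α' : Type}

theorem mean_pure (a : α) (F : α → ℝ≥0∞) : mean (PMF.pure a) F = F a := by
  unfold mean
  rw [tsum_eq_single a]
  · simp
  · intro b hb
    simp [PMF.pure_apply, hb]

theorem mean_bind (p : PMF α) (q : α → PMF α') (F : α' → ℝ≥0∞) :
    mean (p.bind q) F = mean p fun a => mean (q a) F := by
  simp only [mean, PMF.bind_apply, ← ENNReal.tsum_mul_right, ← ENNReal.tsum_mul_left]
  rw [ENNReal.tsum_comm]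
  simp only [mul_assoc]

theorem mean_add (p : PMF α) (F G : α → ℝ≥0∞) :
    mean p (fun a => F a + G a) = mean p F + mean p G := by
  simp only [mean, mul_add, ENNReal.tsum_add]

theorem mean_const_mul (p : PMF α) (c : ℝ≥0∞) (F : α → ℝ≥0∞) :
    mean p (fun a => c * F a) = c * mean p F := by
  simp only [mean, ← ENNReal.tsum_mul_left]
  exact tsum_congr fun a => by ring

theorem mean_mul_const (p : PMF α) (c : ℝ≥0∞) (F : α → ℝ≥0∞) :
    mean p (fun a => F a * c) = mean p F * c := by
  simp only [mean, ← ENNReal.tsum_mul_right]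
  exact tsum_congr fun a => by ring

theorem mean_const (p : PMF α) (c : ℝ≥0∞) : mean p (fun _ => c) = c := by
  simp [mean, ENNReal.tsum_mul_right]

theorem mean_mono (p : PMF α) {F G : α → ℝ≥0∞} (h : ∀ a, F a ≤ G a) : mean p F ≤ mean p G :=
  ENNReal.tsum_le_tsum fun a => by gcongr; exact h a

theorem mean_sum {σ : Type} (p : PMF α) (s : Finset σ) (F : σ → α → ℝ≥0∞) :
    mean p (fun a => ∑ i ∈ s, F i a) = ∑ i ∈ s, mean p (F i) := by
  simp only [mean, Finset.mul_sum]
  exact Summable.tsum_finsetSum fun i _ => ENNReal.summable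

/-- The mixture of `p` and `q` with weights `a` and `b`. -/
def mix (a b : ℝ) (ha : 0 ≤ a) (hb : 0 ≤ b) (hab : a + b = 1) (p q : PMF α) : PMF α :=
  (PMF.ofFintype (fun c : Bool => if c then ENNReal.ofReal a else ENNReal.ofReal b) (by
    simp [← ENNReal.ofReal_add ha hb, hab])).bind fun c => if c then p else q

theorem mean_mix {a b : ℝ} (ha : 0 ≤ a) (hb : 0 ≤ b) (hab : a + b = 1) (p q : PMF α)
    (F : α → ℝ≥0∞) :
    mean (mix a b ha hb hab p q) F = ENNReal.ofReal a * mean p F + ENNReal.ofReal b * mean q F := by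
  rw [mix, mean_bind]
  conv_lhs => unfold mean
  simp [tsum_fintype]
  rfl

end Mean

section Weights

variable {α : Type} [Fintype α]

theorem sum_toReal_pmf (μ : PMF α) : ∑ x, (μ x).toReal = 1 := by
  rw [← ENNReal.toReal_sum fun x _ => μ.apply_ne_top x, ← tsum_fintype (L := .unconditional _),
    μ.tsum_coe, ENNReal.toReal_one]

theorem sum_pmf_mul_ofReal (μ : PMF α) {F : α → ℝ} (hF : ∀ x, 0 ≤ F x) :
    ∑ x, μ x * ENNReal.ofReal (F x) = ENNReal.ofReal (∑ x, (μ x).toReal * F x) := by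
  rw [ENNReal.ofReal_sum_of_nonneg fun x _ => mul_nonneg ENNReal.toReal_nonneg (hF x)]
  refine Finset.sum_congr rfl fun x _ => ?_
  rw [ENNReal.ofReal_mul ENNReal.toReal_nonneg, ENNReal.ofReal_toReal (μ.apply_ne_top x)]

end Weights

/-! ### Composition of trees and their restriction to one block. -/

namespace DecisionTree

variable {ι κ β β' : Type}

/-- Run `T`, and continue with the tree `F b` when the output of `T` is `b`. -/
def bind : DecisionTree ι β → (β → DecisionTree ι β') → DecisionTree ι β'
  | leaf b, F => F b
  | node i l r, F => node i (l.bind F) (r.bind F)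

theorem eval_bind (T : DecisionTree ι β) (F : β → DecisionTree ι β') (x : ι → ℤˣ) :
    (T.bind F).eval x = (F (T.eval x)).eval x := by
  induction T with
  | leaf b => rfl
  | node i l r hl hr => simp only [bind, eval]; split_ifs <;> assumption

theorem queries_bind (T : DecisionTree ι β) (F : β → DecisionTree ι β') (x : ι → ℤˣ) :
    (T.bind F).queries x = T.queries x + (F (T.eval x)).queries x := by
  induction T with
  | leaf b => simp [bind, eval, queries]
  | node i l r hl hr =>
    simp only [bind, eval, queries]
    split_ifs <;> omega

section Expectations

variable [Fintype ι] [DecidableEq ι]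

theorem expectedDepth_eq_ofReal (μ : PMF (ι → ℤˣ)) (T : DecisionTree ι β) :
    T.expectedDepth μ = ENNReal.ofReal (∑ x, (μ x).toReal * (T.queries x : ℝ)) := by
  rw [← sum_pmf_mul_ofReal μ fun x => Nat.cast_nonneg _]
  simp [expectedDepth]

theorem error_eq_ofReal [DecidableEq β] (μ : PMF (ι → ℤˣ)) (g : (ι → ℤˣ) → β) (T : DecisionTree ι β) :
    T.error μ g =
      ENNReal.ofReal (∑ x, (μ x).toReal * (if T.eval x = g x then 0 else 1)) := by
  rw [← sum_pmf_mul_ofReal μ fun x => by split_ifs <;> norm_num]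
  refine Finset.sum_congr rfl fun x _ => ?_
  split_ifs <;> simp

theorem expectedDepth_bind_const (μ : PMF (ι → ℤˣ)) (T : DecisionTree ι β)
    (S : DecisionTree ι β') (F : β → DecisionTree ι β') (hF : ∀ b x, (F b).queries x = S.queries x) :
    (T.bind F).expectedDepth μ = T.expectedDepth μ + S.expectedDepth μ := by
  simp only [expectedDepth, queries_bind, hF, Nat.cast_add, mul_add, Finset.sum_add_distrib]

end Expectations

section Blocks

variable [DecidableEq κ]

/-- The number of queries to the block `j` that a tree makes on the input `X`. -/
def blockQueries (j : κ) : DecisionTree (κ × ι) β → (κ × ι → ℤˣ) → ℕ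
  | leaf _, _ => 0
  | node p l r, X =>
    (if X p = -1 then l.blockQueries j X else r.blockQueries j X) + if p.1 = j then 1 else 0

theorem sum_blockQueries [Fintype κ] (T : DecisionTree (κ × ι) β) (X : κ × ι → ℤˣ) :
    ∑ j, T.blockQueries j X = T.queries X := by
  induction T with
  | leaf b => simp [blockQueries, queries]
  | node p l r hl hr =>
    simp only [blockQueries, queries, Finset.sum_add_distrib]
    split_ifs <;> simp [hl, hr]

/-- `X` with its `j`-th block replaced by `x`. -/
def updateBlock (X : κ × ι → ℤˣ) (j : κ) (x : ι → ℤˣ) : κ × ι → ℤˣ :=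
  fun p => if p.1 = j then x p.2 else X p

/-- The tree on the `j`-th block obtained by fixing the other blocks to those of `X`. -/
def restrict (j : κ) (X : κ × ι → ℤˣ) : DecisionTree (κ × ι) β → DecisionTree ι β
  | leaf b => leaf b
  | node p l r =>
    if p.1 = j then node p.2 (l.restrict j X) (r.restrict j X)
    else if X p = -1 then l.restrict j X else r.restrict j X

theorem eval_restrict (j : κ) (X : κ × ι → ℤˣ) (T : DecisionTree (κ × ι) β) (x : ι → ℤˣ) :
    (T.restrict j X).eval x = T.eval (updateBlock X j x) := by
  induction T with
  | leaf b => rfl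
  | node p l r hl hr =>
    by_cases hp : p.1 = j
    · simp [restrict, eval, updateBlock, hp, ← hl, ← hr]
    · simp only [restrict, eval, updateBlock, hp, if_false]
      split_ifs <;> assumption

theorem queries_restrict (j : κ) (X : κ × ι → ℤˣ) (T : DecisionTree (κ × ι) β) (x : ι → ℤˣ) :
    (T.restrict j X).queries x = T.blockQueries j (updateBlock X j x) := by
  induction T with
  | leaf b => rfl
  | node p l r hl hr =>
    by_cases hp : p.1 = j
    · simp [restrict, queries, blockQueries, updateBlock, hp, ← hl, ← hr]
    · simp only [restrict, blockQueries, updateBlock, hp, if_false]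
      split_ifs <;> assumption

end Blocks

end DecisionTree

open DecisionTree

/-! ### Sums against product measures. -/

variable {n k : ℕ}

theorem sum_prod_block (g : Fin k → (Fin n → ℤˣ) → ℝ) :
    ∑ X : Fin k × Fin n → ℤˣ, ∏ j, g j (block X j) = ∏ j, ∑ x, g j x := by
  rw [← (Equiv.curry (Fin k) (Fin n) ℤˣ).symm.sum_comp]
  have h2 := (Finset.prod_univ_sum (fun _ : Fin k => (Finset.univ : Finset (Fin n → ℤˣ)))
    (fun j x => g j x)).symm
  simp only [Fintype.piFinset_univ] at h2
  exact h2

theorem productPMF_toReal (μ : PMF (Fin n → ℤˣ)) (X : Fin k × Fin n → ℤˣ) :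
    (productPMF μ k X).toReal = ∏ j, (μ (block X j)).toReal := by
  simp [productPMF, PMF.ofFintype_apply, ENNReal.toReal_prod]

theorem block_updateBlock (X : Fin k × Fin n → ℤˣ) (i : Fin k) (x : Fin n → ℤˣ) :
    block (updateBlock X i x) = Function.update (block X) i x := by
  funext j a
  by_cases h : j = i
  · subst h; simp [block, updateBlock]
  · simp [block, updateBlock, h]

/-- Resampling one block of a product distribution does not change expectations. -/
theorem sum_resample (m : (Fin n → ℤˣ) → ℝ) (hm : ∑ x, m x = 1) (i : Fin k)
    (F : (Fin k × Fin n → ℤˣ) → ℝ) :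
    ∑ X : Fin k × Fin n → ℤˣ, (∏ j, m (block X j)) * ∑ x, m x * F (updateBlock X i x) =
      ∑ X : Fin k × Fin n → ℤˣ, (∏ j, m (block X j)) * F X := by
  -- Exchanging the `i`-th block of `X` with the fresh sample `x` is an involution that preserves
  -- the joint weight.
  let e : (Fin k × Fin n → ℤˣ) × (Fin n → ℤˣ) ≃ (Fin k × Fin n → ℤˣ) × (Fin n → ℤˣ) :=
    Function.Involutive.toPerm (fun q => (updateBlock q.1 i q.2, block q.1 i)) (by
      rintro ⟨X, x⟩
      ext p
      · by_cases h : p.1 = i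
        · subst h; simp [updateBlock, block]
        · simp [updateBlock, h]
      · simp [updateBlock, block])
  have hw (X : Fin k × Fin n → ℤˣ) (x : Fin n → ℤˣ) :
      (∏ j, m (block (updateBlock X i x) j)) * m (block X i) = (∏ j, m (block X j)) * m x := by
    rw [block_updateBlock, ← Finset.mul_prod_erase _ _ (Finset.mem_univ i),
      ← Finset.mul_prod_erase _ (fun j => m (block X j)) (Finset.mem_univ i)]
    have h : ∏ j ∈ Finset.univ.erase i, m (Function.update (block X) i x j) =
        ∏ j ∈ Finset.univ.erase i, m (block X j) :=
      Finset.prod_congr rfl fun j hj => by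
        rw [Function.update_of_ne (Finset.ne_of_mem_erase hj)]
    rw [h, Function.update_self]
    ring
  calc _ = ∑ q : (Fin k × Fin n → ℤˣ) × (Fin n → ℤˣ),
        (∏ j, m (block (e q).1 j)) * m (e q).2 * F (e q).1 := by
        rw [Fintype.sum_prod_type]
        refine Finset.sum_congr rfl fun X _ => ?_
        rw [Finset.mul_sum]
        refine Finset.sum_congr rfl fun x _ => ?_
        change _ = (∏ j, m (block (updateBlock X i x) j)) * m (block X i) * F (updateBlock X i x)
        rw [hw]
        ring
    _ = ∑ q : (Fin k × Fin n → ℤˣ) × (Fin n → ℤˣ),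
        (∏ j, m (block q.1 j)) * m q.2 * F q.1 :=
        e.sum_comp fun q => (∏ j, m (block q.1 j)) * m q.2 * F q.1
    _ = _ := by
        rw [Fintype.sum_prod_type]
        refine Finset.sum_congr rfl fun X _ => ?_
        simp only [mul_right_comm _ (m _), ← Finset.mul_sum, hm, mul_one]

/-! ### Accuracy of a tree for the direct product, leaf by leaf. -/

/-- If `∑ A j ≥ θ`, the first term on the right is already at least 1. Otherwise `1 + u ≤ exp u` in
each factor costs at most `exp (θ / 2)` in total. -/
theorem prod_le_sum_div_add {κ : Type} [Fintype κ] {p D A E : κ → ℝ} {θ : ℝ} (hθ : 0 < θ)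
    (hp : ∀ j, 0 ≤ p j) (hp1 : ∀ j, p j ≤ 1) (hpD : ∀ j, p j ≤ 1 - (D j - A j) / 2)
    (hA : ∀ j, 0 ≤ A j) (hE : ∀ j, Real.exp (-(D j / 2)) ≤ E j) :
    ∏ j, p j ≤ θ⁻¹ * ∑ j, A j + Real.exp (θ / 2) * ∏ j, E j := by
  have hE0 : 0 ≤ ∏ j, E j := Finset.prod_nonneg fun j _ => (Real.exp_pos _).le.trans (hE j)
  have hA0 : 0 ≤ ∑ j, A j := Finset.sum_nonneg fun j _ => hA j
  rcases le_or_gt θ (∑ j, A j) with h | h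
  · have h1 : 1 ≤ θ⁻¹ * ∑ j, A j := by
      rw [inv_mul_eq_div, one_le_div hθ]; exact h
    have h2 : ∏ j, p j ≤ 1 := Finset.prod_le_one (fun j _ => hp j) fun j _ => hp1 j
    have := mul_nonneg (Real.exp_pos (θ / 2)).le hE0
    linarith
  · have h1 : ∏ j, p j ≤ ∏ j, (Real.exp (A j / 2) * Real.exp (-(D j / 2))) :=
      Finset.prod_le_prod (fun j _ => hp j) fun j _ => by
        rw [← Real.exp_add]
        have := Real.add_one_le_exp (A j / 2 + -(D j / 2))
        linarith [hpD j]
    have h2 : ∏ j, Real.exp (-(D j / 2)) ≤ ∏ j, E j :=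
      Finset.prod_le_prod (fun j _ => (Real.exp_pos _).le) fun j _ => hE j
    have h3 : ∏ j, Real.exp (A j / 2) ≤ Real.exp (θ / 2) := by
      rw [← Real.exp_sum, ← Finset.sum_div]
      exact Real.exp_le_exp.2 (by linarith)
    rw [Finset.prod_mul_distrib] at h1
    have h4 := mul_le_mul h3 h2 (Finset.prod_nonneg fun j _ => (Real.exp_pos _).le)
      (Real.exp_pos _).le
    have := mul_nonneg (inv_pos.2 hθ).le hA0
    linarith

/-- Jensen's inequality for the exponential and a finite measure. -/
theorem exp_div_le_sum_div {α : Type} [Fintype α] {ν F : α → ℝ} (hν : ∀ x, 0 ≤ ν x)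
    (hm : 0 < ∑ x, ν x) :
    Real.exp ((∑ x, ν x * F x) / ∑ x, ν x) ≤ (∑ x, ν x * Real.exp (F x)) / ∑ x, ν x := by
  have h := convexOn_exp.map_sum_le (t := Finset.univ) (w := fun x => ν x / ∑ y, ν y) (p := F)
    (fun x _ => div_nonneg (hν x) hm.le) (by rw [← Finset.sum_div, div_self hm.ne'])
    fun _ _ => Set.mem_univ _
  simpa [Finset.sum_div, div_mul_eq_mul_div] using h

/-- A sign, as a real number. -/
def sgn (u : ℤˣ) : ℝ := ((u : ℤ) : ℝ)

theorem sgn_one : sgn 1 = 1 := by simp [sgn]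

theorem sgn_neg_one : sgn (-1) = -1 := by simp [sgn]

theorem exists_sgn_mul_eq_abs (r : ℝ) : ∃ s : ℤˣ, r * sgn s = |r| := by
  rcases le_total 0 r with h | h
  · exact ⟨1, by rw [sgn_one, mul_one, abs_of_nonneg h]⟩
  · exact ⟨-1, by rw [sgn_neg_one, mul_neg_one, abs_of_nonpos h]⟩

theorem sgn_mul_sgn (u v : ℤˣ) : sgn u * sgn v = 1 - 2 * (if v = u then 0 else 1) := by
  rcases Int.units_eq_one_or u with rfl | rfl <;> rcases Int.units_eq_one_or v with rfl | rfl <;>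
    norm_num [sgn_one, sgn_neg_one, show (1 : ℤˣ) ≠ -1 by decide, show (-1 : ℤˣ) ≠ 1 by decide]

theorem sum_block_mul (ν : Fin k → (Fin n → ℤˣ) → ℝ) (hν : ∀ j, ∑ x, ν j x ≠ 0) (i : Fin k)
    (φ : (Fin n → ℤˣ) → ℝ) :
    ∑ X : Fin k × Fin n → ℤˣ, (∏ j, ν j (block X j)) * φ (block X i) =
      (∏ j, ∑ x, ν j x) * ((∑ x, ν i x * φ x) / ∑ x, ν i x) := by
  have h (X : Fin k × Fin n → ℤˣ) : (∏ j, ν j (block X j)) * φ (block X i) =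
      ∏ j, ν j (block X j) * (if j = i then φ (block X j) else 1) := by
    rw [Finset.prod_mul_distrib, Fintype.prod_ite_eq' i fun j => φ (block X j)]
  simp only [h]
  rw [sum_prod_block fun j x => ν j x * (if j = i then φ x else 1)]
  rw [← Fintype.prod_ite_eq' i fun j => (∑ x, ν j x * φ x) / ∑ x, ν j x, ← Finset.prod_mul_distrib]
  refine Finset.prod_congr rfl fun j _ => ?_
  split_ifs
  · rw [mul_div_cancel₀ _ (hν j)]
  · simp

/-- The accuracy of a constant guess under a product measure, in terms of the advantages on, and
the exponential moments of, the measure `H`. -/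
theorem accuracy_leaf_le (f : (Fin n → ℤˣ) → ℤˣ) (H : (Fin n → ℤˣ) → ℝ) (hH1 : ∀ x, H x ≤ 1)
    {θ : ℝ} (hθ : 0 < θ)
    (ν : Fin k → (Fin n → ℤˣ) → ℝ) (hν : ∀ j x, 0 ≤ ν j x) (b : Fin k → ℤˣ) :
    ∑ X : Fin k × Fin n → ℤˣ,
        (∏ j, ν j (block X j)) * (if b = directProduct f k X then 1 else 0) ≤
      θ⁻¹ * ∑ i, |∑ X : Fin k × Fin n → ℤˣ,
        (∏ j, ν j (block X j)) * (H (block X i) * sgn (f (block X i)))| +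
      Real.exp (θ / 2) * ∑ X : Fin k × Fin n → ℤˣ,
        (∏ j, ν j (block X j)) * ∏ j, Real.exp (-(H (block X j) / 2)) := by
  have hacc : ∑ X : Fin k × Fin n → ℤˣ,
      (∏ j, ν j (block X j)) * (if b = directProduct f k X then 1 else 0) =
      ∏ j, ∑ x, ν j x * (if b j = f x then 1 else 0) := by
    rw [← sum_prod_block]
    refine Finset.sum_congr rfl fun X _ => ?_
    rw [Finset.prod_mul_distrib]
    congr 1
    rw [Finset.prod_ite_zero]
    simp [funext_iff, directProduct]
  have hexp : ∑ X : Fin k × Fin n → ℤˣ,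
      (∏ j, ν j (block X j)) * ∏ j, Real.exp (-(H (block X j) / 2)) =
      ∏ j, ∑ x, ν j x * Real.exp (-(H x / 2)) := by
    rw [← sum_prod_block]
    exact Finset.sum_congr rfl fun X _ => Finset.prod_mul_distrib.symm
  rw [hacc, hexp]
  have hm0 (j : Fin k) : 0 ≤ ∑ x, ν j x := Finset.sum_nonneg fun x _ => hν j x
  have hE0 : 0 ≤ ∏ j, ∑ x, ν j x * Real.exp (-(H x / 2)) :=
    Finset.prod_nonneg fun j _ => Finset.sum_nonneg fun x _ =>
      mul_nonneg (hν j x) (Real.exp_pos _).le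
  -- A null factor makes the left side vanish; otherwise each `ν j` can be normalized to a
  -- probability measure.
  by_cases hz : ∃ j, ∑ x, ν j x = 0
  · obtain ⟨j, hj⟩ := hz
    rw [Finset.sum_eq_zero_iff_of_nonneg fun x _ => hν j x] at hj
    rw [Finset.prod_eq_zero (Finset.mem_univ j)]
    · have : 0 ≤ θ⁻¹ := (inv_pos.2 hθ).le
      positivity
    · exact Finset.sum_eq_zero fun x hx => by rw [hj x hx, zero_mul]
  push Not at hz
  have hmp (j : Fin k) : 0 < ∑ x, ν j x := lt_of_le_of_ne (hm0 j) (hz j).symm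
  have hM : 0 < ∏ j, ∑ x, ν j x := Finset.prod_pos fun j _ => hmp j
  have hadv (i : Fin k) : |∑ X : Fin k × Fin n → ℤˣ,
      (∏ j, ν j (block X j)) * (H (block X i) * sgn (f (block X i)))| =
      (∏ j, ∑ x, ν j x) * (|∑ x, ν i x * (H x * sgn (f x))| / ∑ x, ν i x) := by
    rw [sum_block_mul ν hz i fun x => H x * sgn (f x), abs_mul, abs_div, abs_of_pos hM,
      abs_of_pos (hmp i)]
  simp only [hadv]
  have key := prod_le_sum_div_add (κ := Fin k) hθ
    (p := fun j => (∑ x, ν j x * (if b j = f x then 1 else 0)) / ∑ x, ν j x)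
    (D := fun j => (∑ x, ν j x * H x) / ∑ x, ν j x)
    (A := fun j => |∑ x, ν j x * (H x * sgn (f x))| / ∑ x, ν j x)
    (E := fun j => (∑ x, ν j x * Real.exp (-(H x / 2))) / ∑ x, ν j x)
    (fun j => div_nonneg (Finset.sum_nonneg fun x _ => mul_nonneg (hν j x) (by split_ifs <;> simp))
      (hm0 j))
    (fun j => by
      rw [div_le_one (hmp j)]
      exact Finset.sum_le_sum fun x _ => mul_le_of_le_one_right (hν j x) (by split_ifs <;> simp))
    (fun j => by
      rw [← sub_div, div_div, mul_comm (∑ x, ν j x), ← div_div, div_le_iff₀ (hmp j), sub_mul,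
        one_mul, div_mul_cancel₀ _ (hz j)]
      have h1 : sgn (b j) * ∑ x, ν j x * (H x * sgn (f x)) ≤
          |∑ x, ν j x * (H x * sgn (f x))| := by
        refine (le_abs_self _).trans ?_
        rw [abs_mul]
        rcases Int.units_eq_one_or (b j) with h | h <;> simp [h, sgn_one, sgn_neg_one]
      -- This holds pointwise: a right guess gives equality, and a wrong guess leaves `0 ≤ ν j x *
      -- (1 - H x)`.
      have h2 : ∑ x, ν j x * (if b j = f x then 1 else 0) ≤ ∑ x, (ν j x -
          (ν j x * H x - sgn (b j) * (ν j x * (H x * sgn (f x)))) / 2) := by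
        refine Finset.sum_le_sum fun x _ => ?_
        have h3 := sgn_mul_sgn (f x) (b j)
        have h4 : sgn (b j) * (ν j x * (H x * sgn (f x))) =
          ν j x * H x * (sgn (f x) * sgn (b j)) := by ring
        have h5 := mul_le_mul_of_nonneg_left (hH1 x) (hν j x)
        rw [h4, h3]
        split_ifs <;> linarith
      rw [Finset.sum_sub_distrib, ← Finset.sum_div, Finset.sum_sub_distrib, ← Finset.mul_sum] at h2
      linarith)
    (fun j => div_nonneg (abs_nonneg _) (hm0 j))
    (fun j => by
      have h := exp_div_le_sum_div (hν j) (hmp j) (F := fun x => -(H x / 2))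
      convert h using 2
      simp only [mul_neg, Finset.sum_neg_distrib, ← mul_div_assoc, ← Finset.sum_div]
      ring)
  rw [Finset.prod_div_distrib, Finset.prod_div_distrib, div_le_iff₀ hM, add_mul] at key
  refine key.trans_eq ?_
  rw [mul_assoc, mul_assoc, div_mul_cancel₀ _ hM.ne', ← Finset.mul_sum]
  ring

/-- Sums the leaf estimate over the tree. `S i` is `T` with each leaf relabeled by the better
constant guess for block `i`, which turns the absolute values at the leaves into one advantage. The
induction needs unnormalized, block-dependent measures `ν`. -/
theorem accuracy_le_exists_labels (f : (Fin n → ℤˣ) → ℤˣ) (H : (Fin n → ℤˣ) → ℝ)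
    (hH1 : ∀ x, H x ≤ 1) {θ : ℝ} (hθ : 0 < θ)
    (T : DecisionTree (Fin k × Fin n) (Fin k → ℤˣ)) :
    ∀ ν : Fin k → (Fin n → ℤˣ) → ℝ, (∀ j x, 0 ≤ ν j x) →
    ∃ S : Fin k → DecisionTree (Fin k × Fin n) ℤˣ,
      (∀ i X, (S i).blockQueries i X = T.blockQueries i X) ∧
      ∑ X : Fin k × Fin n → ℤˣ,
          (∏ j, ν j (block X j)) * (if T.eval X = directProduct f k X then 1 else 0) ≤
        θ⁻¹ * ∑ i, ∑ X : Fin k × Fin n → ℤˣ,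
          (∏ j, ν j (block X j)) *
            (H (block X i) * sgn (f (block X i)) * sgn ((S i).eval X)) +
        Real.exp (θ / 2) * ∑ X : Fin k × Fin n → ℤˣ,
          (∏ j, ν j (block X j)) * ∏ j, Real.exp (-(H (block X j) / 2)) := by
  induction T with
  | leaf b =>
    intro ν hν
    choose s hs using fun i : Fin k => exists_sgn_mul_eq_abs (∑ X : Fin k × Fin n → ℤˣ,
      (∏ j, ν j (block X j)) * (H (block X i) * sgn (f (block X i))))
    refine ⟨fun i => leaf (s i), fun i X => rfl, ?_⟩
    have h := accuracy_leaf_le f H hH1 hθ ν hν b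
    simp only [← hs, Finset.sum_mul, mul_assoc] at h
    simp only [eval, mul_assoc]
    exact h
  | node p l r hl hr =>
    intro ν hν
    -- A query reads a single block, so restricting a product measure to either answer changes one
    -- factor and leaves a product.
    set νl : Fin k → (Fin n → ℤˣ) → ℝ := fun j x =>
      ν j x * (if p.1 = j then (if x p.2 = -1 then 1 else 0) else 1) with hνl
    set νr : Fin k → (Fin n → ℤˣ) → ℝ := fun j x =>
      ν j x * (if p.1 = j then (if x p.2 = -1 then 0 else 1) else 1) with hνr
    obtain ⟨Sl, hSl, hl⟩ := hl νl fun j x =>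
      mul_nonneg (hν j x) (by split_ifs <;> norm_num)
    obtain ⟨Sr, hSr, hr⟩ := hr νr fun j x =>
      mul_nonneg (hν j x) (by split_ifs <;> norm_num)
    have hWl (X : Fin k × Fin n → ℤˣ) : ∏ j, νl j (block X j) =
        (∏ j, ν j (block X j)) * (if X p = -1 then 1 else 0) := by
      rw [hνl, Finset.prod_mul_distrib,
        Fintype.prod_ite_eq p.1 fun j => if block X j p.2 = -1 then (1 : ℝ) else 0]
      rfl
    have hWr (X : Fin k × Fin n → ℤˣ) : ∏ j, νr j (block X j) =
        (∏ j, ν j (block X j)) * (if X p = -1 then 0 else 1) := by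
      rw [hνr, Finset.prod_mul_distrib,
        Fintype.prod_ite_eq p.1 fun j => if block X j p.2 = -1 then (0 : ℝ) else 1]
      rfl
    have split (F G K : (Fin k × Fin n → ℤˣ) → ℝ)
        (h : ∀ X, K X = if X p = -1 then F X else G X) :
        ∑ X : Fin k × Fin n → ℤˣ, (∏ j, ν j (block X j)) * K X =
          ∑ X : Fin k × Fin n → ℤˣ, (∏ j, νl j (block X j)) * F X +
          ∑ X : Fin k × Fin n → ℤˣ, (∏ j, νr j (block X j)) * G X := by
      rw [← Finset.sum_add_distrib]
      refine Finset.sum_congr rfl fun X _ => ?_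
      rw [hWl, hWr, h]
      split_ifs <;> ring
    refine ⟨fun i => node p (Sl i) (Sr i), fun i X => ?_, ?_⟩
    · simp only [blockQueries, hSl, hSr]
    · rw [split (fun X => if l.eval X = directProduct f k X then 1 else 0)
          (fun X => if r.eval X = directProduct f k X then 1 else 0) _
          (fun X => by simp only [eval]; split_ifs <;> rfl),
        split (fun X => ∏ j, Real.exp (-(H (block X j) / 2)))
          (fun X => ∏ j, Real.exp (-(H (block X j) / 2))) _ (fun X => by simp),
        Finset.sum_congr rfl fun i _ => split
          (fun X => H (block X i) * sgn (f (block X i)) * sgn ((Sl i).eval X))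
          (fun X => H (block X i) * sgn (f (block X i)) * sgn ((Sr i).eval X)) _
          (fun X => by simp only [eval]; split_ifs <;> rfl),
        Finset.sum_add_distrib]
      linarith

/-- If trees on a single block have small advantage on `H`, then so do trees on all blocks. -/
theorem advantage_block_le {m : (Fin n → ℤˣ) → ℝ} (hm0 : ∀ x, 0 ≤ m x) (hm : ∑ x, m x = 1)
    (f : (Fin n → ℤˣ) → ℤˣ) (H : (Fin n → ℤˣ) → ℝ) {a c : ℝ}
    (hard : ∀ T : DecisionTree (Fin n) ℤˣ, ∑ x, m x * (H x * sgn (f x) * sgn (T.eval x)) ≤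
      a + c * ∑ x, m x * (T.queries x : ℝ))
    (i : Fin k) (S : DecisionTree (Fin k × Fin n) ℤˣ) :
    ∑ X : Fin k × Fin n → ℤˣ, (∏ j, m (block X j)) *
        (H (block X i) * sgn (f (block X i)) * sgn (S.eval X)) ≤
      a + c * ∑ X : Fin k × Fin n → ℤˣ, (∏ j, m (block X j)) * (S.blockQueries i X : ℝ) := by
  have hself (X : Fin k × Fin n → ℤˣ) (x : Fin n → ℤˣ) : block (updateBlock X i x) i = x := by
    rw [block_updateBlock, Function.update_self]
  -- Resampling block `i` exposes an inner average over that block with the others fixed, where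
  -- `S.restrict i X` is a tree to which `hard` applies.
  rw [← sum_resample m hm i, ← sum_resample m hm i fun X => (S.blockQueries i X : ℝ)]
  have hone : ∑ X : Fin k × Fin n → ℤˣ, ∏ j, m (block X j) = 1 := by
    rw [sum_prod_block fun _ => m]; simp [hm]
  calc _ ≤ ∑ X : Fin k × Fin n → ℤˣ, (∏ j, m (block X j)) *
        (a + c * ∑ x, m x * (S.blockQueries i (updateBlock X i x) : ℝ)) := by
        refine Finset.sum_le_sum fun X _ => ?_
        refine mul_le_mul_of_nonneg_left ?_ (Finset.prod_nonneg fun j _ => hm0 _)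
        simpa only [hself, eval_restrict, queries_restrict] using hard (S.restrict i X)
    _ = _ := by
        simp only [mul_add, Finset.sum_add_distrib, ← Finset.sum_mul, hone, one_mul,
          mul_left_comm _ c, ← Finset.mul_sum]

theorem accuracy_le {m : (Fin n → ℤˣ) → ℝ} (hm0 : ∀ x, 0 ≤ m x) (hm : ∑ x, m x = 1)
    (f : (Fin n → ℤˣ) → ℤˣ) (H : (Fin n → ℤˣ) → ℝ) (hH1 : ∀ x, H x ≤ 1) {a c θ : ℝ}
    (hθ : 0 < θ)
    (hard : ∀ T : DecisionTree (Fin n) ℤˣ, ∑ x, m x * (H x * sgn (f x) * sgn (T.eval x)) ≤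
      a + c * ∑ x, m x * (T.queries x : ℝ))
    (T : DecisionTree (Fin k × Fin n) (Fin k → ℤˣ)) :
    ∑ X : Fin k × Fin n → ℤˣ,
        (∏ j, m (block X j)) * (if T.eval X = directProduct f k X then 1 else 0) ≤
      θ⁻¹ * (k * a + c * ∑ X : Fin k × Fin n → ℤˣ, (∏ j, m (block X j)) * (T.queries X : ℝ)) +
      Real.exp (θ / 2) * (∑ x, m x * Real.exp (-(H x / 2))) ^ k := by
  obtain ⟨S, hS, h⟩ := accuracy_le_exists_labels f H hH1 hθ T (fun _ => m) fun _ => hm0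
  have hexp : ∑ X : Fin k × Fin n → ℤˣ,
      (∏ j, m (block X j)) * ∏ j, Real.exp (-(H (block X j) / 2)) =
      (∑ x, m x * Real.exp (-(H x / 2))) ^ k := by
    simp only [← Finset.prod_mul_distrib]
    rw [sum_prod_block fun _ x => m x * Real.exp (-(H x / 2))]
    simp
  rw [hexp] at h
  refine h.trans (add_le_add_left (mul_le_mul_of_nonneg_left ?_ (inv_pos.2 hθ).le) _)
  calc _ ≤ ∑ i : Fin k, (a + c * ∑ X : Fin k × Fin n → ℤˣ,
        (∏ j, m (block X j)) * ((S i).blockQueries i X : ℝ)) :=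
        Finset.sum_le_sum fun i _ => advantage_block_le hm0 hm f H hard i (S i)
    _ = _ := by
        simp only [hS]
        rw [Finset.sum_add_distrib, ← Finset.mul_sum, Finset.sum_comm]
        simp only [← Finset.mul_sum, ← Nat.cast_sum, sum_blockQueries]
        simp

/-! ### Minimax over measures of fixed density. -/

/-- A bilinear minimax principle: if every `H` in a compact convex set has a good response in the
convex set `K`, then a single element of `K` is a good response to all of them. -/
theorem exists_common_response {α : Type} [Fintype α] (w : α → ℝ) {S K : Set (α → ℝ)}
    (hS : IsCompact S) (hSc : Convex ℝ S) (hSn : S.Nonempty) (hK : Convex ℝ K) {c : ℝ}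
    (h : ∀ H ∈ S, ∃ v ∈ K, c < ∑ x, w x * (H x * v x)) :
    ∃ v ∈ K, ∀ H ∈ S, c < ∑ x, w x * (H x * v x) := by
  -- Only `S` is compact. The strict inequality is open in `H`, so finitely many responses from `K`
  -- suffice, and Sion's theorem combines them into one.
  obtain ⟨t, htK, htf, ht⟩ := hS.elim_finite_subcover_image (b := K)
    (c := fun v => {H | c < ∑ x, w x * (H x * v x)})
    (fun v _ => isOpen_lt continuous_const (by fun_prop))
    (fun H hH => by simpa using h H hH)
  have hlin1 (v : α → ℝ) : IsLinearMap ℝ fun H : α → ℝ => ∑ x, w x * (H x * v x) :=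
    ⟨fun H H' => by simp only [Pi.add_apply, ← Finset.sum_add_distrib]; congr! 1; ring,
      fun r H => by simp only [Pi.smul_apply, smul_eq_mul, Finset.mul_sum]; congr! 1; ring⟩
  have hlin2 (H : α → ℝ) : IsLinearMap ℝ fun v : α → ℝ => ∑ x, w x * (H x * v x) :=
    ⟨fun H H' => by simp only [Pi.add_apply, ← Finset.sum_add_distrib]; congr! 1; ring,
      fun r H => by simp only [Pi.smul_apply, smul_eq_mul, Finset.mul_sum]; congr! 1; ring⟩
  exact Sion.exists_lt_iInf_of_lt_iInf_of_finite (β := ℝ)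
    (f := fun H v : α → ℝ => ∑ x, w x * (H x * v x)) hSn hS
    (fun v _ => (Continuous.lowerSemicontinuous (by fun_prop)).lowerSemicontinuousOn _)
    (fun v _ => (((hlin1 v).mk' _).convexOn hSc).quasiconvexOn) hK
    (fun H _ => (Continuous.upperSemicontinuous (by fun_prop)).upperSemicontinuousOn _)
    (fun H _ => (((hlin2 H).mk' _).concaveOn hK).quasiconcaveOn) hSc htf htK
    (fun H hH => by simpa using ht hH)

/-- The functions `H : α → [0,1]` of density `s` with respect to the weights `m`. -/
def densityPolytope {α : Type} [Fintype α] (m : α → ℝ) (s : ℝ) : Set (α → ℝ) :=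
  {H | (∀ x, H x ∈ Set.Icc (0 : ℝ) 1) ∧ ∑ x, m x * H x = s}

section DensityPolytope

variable {α : Type} [Fintype α] {m : α → ℝ} {s : ℝ}

theorem isCompact_densityPolytope : IsCompact (densityPolytope m s) := by
  have h := isCompact_univ_pi fun _ : α => isCompact_Icc (a := (0 : ℝ)) (b := 1)
  have hc : IsClosed {H : α → ℝ | ∑ x, m x * H x = s} :=
    isClosed_eq (by fun_prop) continuous_const
  convert h.inter_right hc using 1
  ext H
  simp only [densityPolytope, Set.mem_ofPred_eq, Set.mem_inter_iff, Set.mem_univ_pi]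

theorem convex_densityPolytope : Convex ℝ (densityPolytope m s) := by
  intro H hH H' hH' a b ha hb hab
  refine ⟨fun x => convex_Icc (0 : ℝ) 1 (hH.1 x) (hH'.1 x) ha hb hab, ?_⟩
  have h (x : α) : m x * (a • H + b • H') x = a * (m x * H x) + b * (m x * H' x) := by
    simp only [Pi.add_apply, Pi.smul_apply, smul_eq_mul]; ring
  simp only [h, Finset.sum_add_distrib, ← Finset.mul_sum, hH.2, hH'.2]
  rw [← add_mul, hab, one_mul]

theorem nonempty_densityPolytope (hm : ∑ x, m x = 1) (hs0 : 0 ≤ s) (hs1 : s ≤ 1) :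
    (densityPolytope m s).Nonempty :=
  ⟨fun _ => s, fun _ => ⟨hs0, hs1⟩, by rw [← Finset.sum_mul, hm, one_mul]⟩

end DensityPolytope

/-! ### Correlation of random trees and amplification by majority vote. -/

section Randomized

variable {ι : Type}

/-- The probability that the output of a random tree on `x` is wrong. -/
def wrongProb (R : RandomizedTree ι ℤˣ) (f : (ι → ℤˣ) → ℤˣ) (x : ι → ℤˣ) : ℝ≥0∞ :=
  mean R fun T => if T.eval x = f x then 0 else 1

/-- The correlation of the output of a random tree with the value of `f` at `x`. -/
def correlation (R : RandomizedTree ι ℤˣ) (f : (ι → ℤˣ) → ℤˣ) (x : ι → ℤˣ) : ℝ :=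
  1 - 2 * (wrongProb R f x).toReal

variable {R : RandomizedTree ι ℤˣ} {f : (ι → ℤˣ) → ℤˣ} {x : ι → ℤˣ}

theorem wrongProb_le_one : wrongProb R f x ≤ 1 := by
  refine (mean_mono R (G := fun _ => 1) fun T => ?_).trans_eq (mean_const R 1)
  split_ifs <;> simp

theorem wrongProb_ne_top : wrongProb R f x ≠ ⊤ := ne_top_of_le_ne_top (by simp) wrongProb_le_one

theorem correlation_pure (T : DecisionTree ι ℤˣ) :
    correlation (PMF.pure T) f x = sgn (f x) * sgn (T.eval x) := by
  rw [correlation, wrongProb, mean_pure, sgn_mul_sgn]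
  split_ifs <;> simp

theorem correlation_mix {a b : ℝ} (ha : 0 ≤ a) (hb : 0 ≤ b) (hab : a + b = 1)
    (R' : RandomizedTree ι ℤˣ) :
    correlation (mix a b ha hb hab R R') f x =
      a * correlation R f x + b * correlation R' f x := by
  have h : wrongProb (mix a b ha hb hab R R') f x =
      ENNReal.ofReal a * wrongProb R f x + ENNReal.ofReal b * wrongProb R' f x :=
    mean_mix ha hb hab R R' _
  rw [correlation, correlation, correlation, h,
    ENNReal.toReal_add (ENNReal.mul_ne_top ENNReal.ofReal_ne_top wrongProb_ne_top)
      (ENNReal.mul_ne_top ENNReal.ofReal_ne_top wrongProb_ne_top),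
    ENNReal.toReal_mul, ENNReal.toReal_mul, ENNReal.toReal_ofReal ha, ENNReal.toReal_ofReal hb]
  linear_combination (-1 : ℝ) * hab

theorem expectedDepth_mix [Fintype ι] [DecidableEq ι] (μ : PMF (ι → ℤˣ))
    {a b : ℝ} (ha : 0 ≤ a) (hb : 0 ≤ b) (hab : a + b = 1) (R' : RandomizedTree ι ℤˣ) :
    RandomizedTree.expectedDepth μ (mix a b ha hb hab R R') =
      ENNReal.ofReal a * RandomizedTree.expectedDepth μ R +
        ENNReal.ofReal b * RandomizedTree.expectedDepth μ R' :=
  mean_mix ha hb hab R R' _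

theorem expectedDepth_pure [Fintype ι] [DecidableEq ι] (μ : PMF (ι → ℤˣ)) (T : DecisionTree ι ℤˣ) :
    RandomizedTree.expectedDepth μ (PMF.pure T) = T.expectedDepth μ :=
  mean_pure _ _

theorem error_eq_sum_wrongProb [Fintype ι] [DecidableEq ι] (μ : PMF (ι → ℤˣ)) :
    RandomizedTree.error μ f R = ∑ x, μ x * wrongProb R f x := by
  have h : RandomizedTree.error μ f R =
      mean R fun T => ∑ x, μ x * (if T.eval x = f x then 0 else 1) := rfl
  simp only [h, mean_sum, mean_const_mul]
  rfl

/-- The sum of the outputs of `t` independent copies of a random tree. -/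
def voteCount (R : RandomizedTree ι ℤˣ) : ℕ → RandomizedTree ι ℤ
  | 0 => PMF.pure (leaf 0)
  | t + 1 => PMF.bind R fun T => PMF.bind (voteCount R t) fun S =>
      PMF.pure (T.bind fun u => S.bind fun v => leaf ((u : ℤ) + v))

/-- The majority vote of `t` independent copies of a random tree. -/
def majority (R : RandomizedTree ι ℤˣ) (t : ℕ) : RandomizedTree ι ℤˣ :=
  PMF.bind (voteCount R t) fun S => PMF.pure (S.bind fun v => leaf (if 0 < v then 1 else -1))

theorem expectedDepth_voteCount [Fintype ι] [DecidableEq ι] (μ : PMF (ι → ℤˣ)) (t : ℕ) :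
    RandomizedTree.expectedDepth μ (voteCount R t) = t * RandomizedTree.expectedDepth μ R := by
  induction t with
  | zero =>
    refine (mean_pure (leaf 0) fun S : DecisionTree ι ℤ => S.expectedDepth μ).trans ?_
    simp [DecisionTree.expectedDepth, queries]
  | succ t ih =>
    change mean (voteCount R t) (fun S => S.expectedDepth μ) = t * mean R _ at ih
    change mean (voteCount R (t + 1)) (fun S => S.expectedDepth μ) = (t + 1 : ℕ) * mean R _
    simp only [voteCount, mean_bind, mean_pure]
    have h (T : DecisionTree ι ℤˣ) (S : DecisionTree ι ℤ) :
        (T.bind fun u => S.bind fun v => leaf ((u : ℤ) + v)).expectedDepth μ =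
          T.expectedDepth μ + S.expectedDepth μ :=
      expectedDepth_bind_const μ T S _ fun u x => by simp [queries_bind, queries]
    simp only [h, mean_add, mean_const, ih, Nat.cast_add, Nat.cast_one]
    ring

theorem expectedDepth_majority [Fintype ι] [DecidableEq ι] (μ : PMF (ι → ℤˣ)) (t : ℕ) :
    RandomizedTree.expectedDepth μ (majority R t) = t * RandomizedTree.expectedDepth μ R := by
  rw [← expectedDepth_voteCount]
  change mean (majority R t) (fun S => S.expectedDepth μ) =
    mean (voteCount R t) fun S => S.expectedDepth μ
  simp only [majority, mean_bind, mean_pure]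
  congr! 2 with S
  simp [DecisionTree.expectedDepth, queries_bind, queries]

/-- The exponential moment of the vote count is multiplicative. -/
theorem mean_voteCount_zpow {a : ℝ} (ha : 0 < a) (t : ℕ) (u : ℤˣ) :
    mean (voteCount R t) (fun S => ENNReal.ofReal (a ^ ((u : ℤ) * S.eval x))) =
      mean R (fun T => ENNReal.ofReal (a ^ ((u : ℤ) * (T.eval x : ℤ)))) ^ t := by
  induction t with
  | zero => simp [voteCount, mean_pure, eval]
  | succ t ih =>
    simp only [voteCount, mean_bind, mean_pure, eval_bind, eval, mul_add, zpow_add₀ ha.ne']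
    simp only [ENNReal.ofReal_mul (zpow_pos ha _).le, mean_const_mul, mean_mul_const, ih]
    ring

/-- A Chernoff bound with base `1 - g`: a wrong majority makes the exponent `f x` times the vote
count nonpositive, so the power is at least 1. One vote has exponential moment at most `1 - g + ((1
- g)⁻¹ - (1 - g)) * (1 - g) / 2 = 1 - g ^ 2 / 2`. -/
theorem wrongProb_majority_le {g : ℝ} (hg0 : 0 < g) (hg1 : g < 1) (h : g < correlation R f x)
    (t : ℕ) : wrongProb (majority R t) f x ≤ ENNReal.ofReal ((1 - g ^ 2 / 2) ^ t) := by
  have ha : 0 < 1 - g := by linarith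
  have ha1 : 1 - g ≤ 1 := by linarith
  have hinv : 1 - g ≤ (1 - g)⁻¹ := ha1.trans ((one_le_inv₀ ha).2 ha1)
  have h1 : mean R (fun T => ENNReal.ofReal ((1 - g) ^ ((f x : ℤ) * (T.eval x : ℤ)))) ≤
      ENNReal.ofReal (1 - g ^ 2 / 2) := by
    have h2 (T : DecisionTree ι ℤˣ) : ENNReal.ofReal ((1 - g) ^ ((f x : ℤ) * (T.eval x : ℤ))) =
        ENNReal.ofReal (1 - g) + ENNReal.ofReal ((1 - g)⁻¹ - (1 - g)) *
          (if T.eval x = f x then 0 else 1) := by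
      have h3 : (f x : ℤ) * (T.eval x : ℤ) = if T.eval x = f x then 1 else -1 := by
        rcases Int.units_eq_one_or (f x) with h | h <;>
          rcases Int.units_eq_one_or (T.eval x) with h' | h' <;>
          simp [h, h', show (1 : ℤˣ) ≠ -1 by decide, show (-1 : ℤˣ) ≠ 1 by decide]
      rw [h3]
      split_ifs
      · simp
      · rw [mul_one, ← ENNReal.ofReal_add ha.le (by linarith), zpow_neg_one]
        congr 1
        ring
    simp only [h2, mean_add, mean_const, mean_const_mul]
    change _ + _ * wrongProb R f x ≤ _
    rw [← ENNReal.ofReal_toReal (wrongProb_ne_top (R := R) (f := f) (x := x)),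
      ← ENNReal.ofReal_mul (by linarith), ← ENNReal.ofReal_add ha.le
        (mul_nonneg (by linarith) ENNReal.toReal_nonneg)]
    refine ENNReal.ofReal_le_ofReal ?_
    have hp : (wrongProb R f x).toReal ≤ (1 - g) / 2 := by
      unfold correlation at h; linarith
    calc _ ≤ 1 - g + ((1 - g)⁻¹ - (1 - g)) * ((1 - g) / 2) := by
          have := mul_le_mul_of_nonneg_left hp (sub_nonneg.2 hinv)
          linarith
      _ = _ := by field_simp; ring
  have hg2 : 0 ≤ 1 - g ^ 2 / 2 := by nlinarith
  rw [ENNReal.ofReal_pow hg2]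
  refine le_trans ?_ (pow_le_pow_left₀ zero_le h1 t)
  rw [← mean_voteCount_zpow ha, wrongProb, majority, mean_bind]
  refine mean_mono _ fun S => ?_
  rw [mean_pure, eval_bind, eval]
  -- A tied vote outputs -1; if this is wrong the exponent is 0, which the nonstrict bound still
  -- covers.
  split_ifs with h5 h6 h6
  · exact zero_le
  · refine ENNReal.one_le_ofReal.2 (one_le_zpow_of_nonpos₀ ha ha1 ?_)
    have : f x = -1 := (Int.units_eq_one_or (f x)).resolve_left fun h => h6 h.symm
    rw [this]; simp; omega
  · exact zero_le
  · refine ENNReal.one_le_ofReal.2 (one_le_zpow_of_nonpos₀ ha ha1 ?_)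
    have : f x = 1 := (Int.units_eq_one_or (f x)).resolve_right fun h => h6 h.symm
    rw [this]; simp; omega

end Randomized

/-! ### The hardcore theorem. -/

section Hardcore

variable {n : ℕ}

/-- If a random tree of small depth has correlation above `g` with `f` on every measure of
density `s`, then its majority vote computes `f` to error at most `2 s`. -/
theorem error_majority_le (f : (Fin n → ℤˣ) → ℤˣ) (μ : PMF (Fin n → ℤˣ)) {s g : ℝ} (hs : 0 < s)
    (hg0 : 0 < g) (hg1 : g < 1) {t : ℕ} (ht : (1 - g ^ 2 / 2) ^ t ≤ s)
    (R : RandomizedTree (Fin n) ℤˣ)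
    (hR : ∀ H ∈ densityPolytope (fun x => (μ x).toReal) s,
      g * s < ∑ x, (μ x).toReal * (H x * correlation R f x)) :
    (RandomizedTree.error μ f (majority R t)).toReal ≤ 2 * s := by
  classical
  have hm0 (x : Fin n → ℤˣ) : 0 ≤ (μ x).toReal := ENNReal.toReal_nonneg
  set M := ∑ x, (μ x).toReal * (if correlation R f x ≤ g then 1 else 0) with hM
  -- Were the set of low correlation of mass at least `s`, its indicator scaled to density `s` would
  -- contradict `hR`.
  have hMs : M < s := by
    by_contra! hsM
    have hMpos : 0 < M := hs.trans_le hsM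
    have hsM0 : 0 ≤ s / M := (div_pos hs hMpos).le
    have h1 := hR (fun x => s / M * (if correlation R f x ≤ g then 1 else 0)) ⟨fun x => by
      have : s / M ≤ 1 := (div_le_one hMpos).2 hsM
      dsimp only
      split_ifs <;> constructor <;> linarith, by
      simp only [mul_left_comm _ (s / M), ← Finset.mul_sum]
      rw [← hM, div_mul_cancel₀ _ hMpos.ne']⟩
    have h2 : ∑ x, (μ x).toReal *
        (s / M * (if correlation R f x ≤ g then 1 else 0) * correlation R f x) ≤
        ∑ x, s / M * ((μ x).toReal * (if correlation R f x ≤ g then 1 else 0)) * g := by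
      refine Finset.sum_le_sum fun x _ => ?_
      split_ifs with h
      · have := mul_le_mul_of_nonneg_left h (mul_nonneg hsM0 (hm0 x))
        linarith
      · simp
    rw [← Finset.sum_mul, ← Finset.mul_sum, ← hM, div_mul_cancel₀ _ hMpos.ne'] at h2
    linarith
  have h1 : RandomizedTree.error μ f (majority R t) ≤
      ∑ x, μ x * ENNReal.ofReal ((if correlation R f x ≤ g then 1 else 0) + s) := by
    rw [error_eq_sum_wrongProb]
    refine Finset.sum_le_sum fun x _ => mul_le_mul_right ?_ _
    split_ifs with h
    · exact wrongProb_le_one.trans (ENNReal.one_le_ofReal.2 (by linarith))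
    · exact (wrongProb_majority_le hg0 hg1 (not_le.1 h) t).trans
        (ENNReal.ofReal_le_ofReal (by linarith))
  rw [sum_pmf_mul_ofReal μ fun x => by split_ifs <;> linarith] at h1
  refine ENNReal.toReal_le_of_le_ofReal (by linarith) (h1.trans (ENNReal.ofReal_le_ofReal ?_))
  simp only [mul_add, Finset.sum_add_distrib, ← Finset.sum_mul, sum_toReal_pmf]
  linarith

/-- **Hardcore theorem** for expected query complexity: if `f` cannot be computed to error `2 s`
with expected depth `t * d`, then there is a measure of density `s` on which the advantage of every
tree is small in terms of its expected depth. -/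
theorem exists_hardcore (f : (Fin n → ℤˣ) → ℤˣ) (μ : PMF (Fin n → ℤˣ)) {s g d : ℝ} (hs : 0 < s)
    (hs1 : s ≤ 1) (hg0 : 0 < g) (hg1 : g < 1) (hd : 0 < d) {t : ℕ}
    (ht : (1 - g ^ 2 / 2) ^ t ≤ s) (hdepth : t * ENNReal.ofReal d < avgDepth μ f (2 * s)) :
    ∃ H ∈ densityPolytope (fun x => (μ x).toReal) s, ∀ T : DecisionTree (Fin n) ℤˣ,
      ∑ x, (μ x).toReal * (H x * sgn (f x) * sgn (T.eval x)) ≤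
        g * s + g * s / d * ∑ x, (μ x).toReal * (T.queries x : ℝ) := by
  -- The bound for random trees of expected depth at most `d`; deeper trees are reduced to it below.
  have step : ∃ H ∈ densityPolytope (fun x => (μ x).toReal) s, ∀ R : RandomizedTree (Fin n) ℤˣ,
      RandomizedTree.expectedDepth μ R ≤ ENNReal.ofReal d →
        ∑ x, (μ x).toReal * (H x * correlation R f x) ≤ g * s := by
    by_contra! hno
    obtain ⟨v, ⟨R, hR, rfl⟩, hv⟩ := exists_common_response (fun x => (μ x).toReal)
      (K := {v | ∃ R : RandomizedTree (Fin n) ℤˣ,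
        RandomizedTree.expectedDepth μ R ≤ ENNReal.ofReal d ∧ correlation R f = v})
      isCompact_densityPolytope convex_densityPolytope
      (nonempty_densityPolytope (sum_toReal_pmf μ) hs.le hs1)
      (by
        rintro _ ⟨R, hR, rfl⟩ _ ⟨R', hR', rfl⟩ a b ha hb hab
        refine ⟨mix a b ha hb hab R R', ?_, ?_⟩
        · rw [expectedDepth_mix]
          calc _ ≤ ENNReal.ofReal a * ENNReal.ofReal d + ENNReal.ofReal b * ENNReal.ofReal d := by
                gcongr
            _ = _ := by rw [← add_mul, ← ENNReal.ofReal_add ha hb, hab]; simp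
        · funext x
          rw [correlation_mix]
          rfl)
      (c := g * s) (fun H hH => by
        obtain ⟨R, hR, h⟩ := hno H hH
        exact ⟨_, ⟨R, hR, rfl⟩, h⟩)
    have herr := error_majority_le f μ hs hg0 hg1 ht R hv
    have h2 : avgDepth μ f (2 * s) ≤ RandomizedTree.expectedDepth μ (majority R t) :=
      iInf₂_le (majority R t) herr
    rw [expectedDepth_majority] at h2
    have h3 : (t : ℝ≥0∞) * RandomizedTree.expectedDepth μ R ≤ t * ENNReal.ofReal d := by gcongr
    exact absurd (h2.trans h3) (not_le.2 hdepth)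
  obtain ⟨H, hH, hstep⟩ := step
  refine ⟨H, hH, fun T => ?_⟩
  have hpay (T : DecisionTree (Fin n) ℤˣ) :
      ∑ x, (μ x).toReal * (H x * correlation (PMF.pure T) f x) =
        ∑ x, (μ x).toReal * (H x * sgn (f x) * sgn (T.eval x)) := by
    simp only [correlation_pure, mul_assoc]
  set q := ∑ x, (μ x).toReal * (T.queries x : ℝ) with hq
  have hq0 : 0 ≤ q := Finset.sum_nonneg fun x _ =>
    mul_nonneg ENNReal.toReal_nonneg (Nat.cast_nonneg _)
  have hgs : 0 < g * s := mul_pos hg0 hs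
  rcases le_or_gt q d with hqd | hqd
  · have h1 := hstep (PMF.pure T) (by
      rw [expectedDepth_pure, expectedDepth_eq_ofReal]; exact ENNReal.ofReal_le_ofReal hqd)
    rw [hpay] at h1
    have := mul_nonneg (div_pos hgs hd).le hq0
    linarith
  -- A tree of expected depth `q > d` is run with probability `d / q`, and otherwise the better
  -- constant is output. The mixture has expected depth `d`, and the constant's advantage is
  -- nonnegative, so the tree's own advantage is at most `q / d` times the bound.
  · have hqp : 0 < q := hd.trans hqd
    obtain ⟨b, hb⟩ := exists_sgn_mul_eq_abs (∑ x, (μ x).toReal * (H x * sgn (f x)))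
    have ha0 : 0 ≤ d / q := (div_pos hd hqp).le
    have hb0 : 0 ≤ 1 - d / q := sub_nonneg.2 ((div_le_one hqp).2 hqd.le)
    have h1 := hstep (mix (d / q) (1 - d / q) ha0 hb0 (by ring) (PMF.pure T)
      (PMF.pure (leaf b))) (by
      rw [expectedDepth_mix, expectedDepth_pure, expectedDepth_pure, expectedDepth_eq_ofReal,
        ← hq, ← ENNReal.ofReal_mul ha0, div_mul_cancel₀ _ hqp.ne']
      simp [DecisionTree.expectedDepth, queries])
    simp only [correlation_mix, mul_add, Finset.sum_add_distrib, mul_left_comm _ (d / q),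
      mul_left_comm _ (1 - d / q), ← Finset.mul_sum] at h1
    rw [hpay, hpay] at h1
    have h2 : 0 ≤ ∑ x, (μ x).toReal *
        (H x * sgn (f x) * sgn ((leaf b : DecisionTree (Fin n) ℤˣ).eval x)) := by
      simp only [eval, ← mul_assoc] at hb ⊢
      rw [← Finset.sum_mul, hb]
      exact abs_nonneg _
    have h3 := mul_nonneg hb0 h2
    have h4 : d / q * (∑ x, (μ x).toReal * (H x * sgn (f x) * sgn (T.eval x))) ≤ g * s := by
      linarith
    rw [div_mul_eq_mul_div, div_le_iff₀ hqp] at h4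
    have h5 : g * s / d * q = g * s * q / d := by ring
    rw [h5]
    have h6 : ∑ x, (μ x).toReal * (H x * sgn (f x) * sgn (T.eval x)) ≤ g * s * q / d := by
      rw [le_div_iff₀ hd]; linarith
    linarith

end Hardcore

/-! ### Elementary properties of the minimum expected depth. -/

section AvgDepth

variable {ι β : Type} [Fintype ι] [DecidableEq ι] [DecidableEq β]

theorem avgDepth_anti (μ : PMF (ι → ℤˣ)) (g : (ι → ℤˣ) → β) {ε ε' : ℝ} (h : ε ≤ ε') :
    avgDepth μ g ε' ≤ avgDepth μ g ε :=
  le_iInf₂ fun R hR => iInf₂_le R (hR.trans h)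

/-- A constant tree computes any function to error at most `1 / 2`. -/
theorem avgDepth_eq_zero (μ : PMF (ι → ℤˣ)) (f : (ι → ℤˣ) → ℤˣ) {δ : ℝ} (hδ : 1 / 2 ≤ δ) :
    avgDepth μ f δ = 0 := by
  have key (b : ℤˣ) (hb : ∑ x, (μ x).toReal * (if b = f x then 0 else 1) ≤ 1 / 2) :
      avgDepth μ f δ = 0 := by
    refine le_antisymm ?_ zero_le
    refine (iInf₂_le (PMF.pure (leaf b)) ?_).trans_eq ?_
    · have h : RandomizedTree.error μ f (PMF.pure (leaf b)) =
          DecisionTree.error μ f (leaf b) := mean_pure _ _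
      rw [h, error_eq_ofReal]
      exact ENNReal.toReal_le_of_le_ofReal (by linarith) (ENNReal.ofReal_le_ofReal (hb.trans hδ))
    · rw [expectedDepth_pure]
      simp [DecisionTree.expectedDepth, queries]
  rcases le_or_gt (∑ x, (μ x).toReal * (if (1 : ℤˣ) = f x then 0 else 1)) (1 / 2) with h | h
  · exact key 1 h
  · refine key (-1) ?_
    have h1 : ∑ x, (μ x).toReal * (if (1 : ℤˣ) = f x then 0 else 1) +
        ∑ x, (μ x).toReal * (if (-1 : ℤˣ) = f x then 0 else 1) = 1 := by
      rw [← Finset.sum_add_distrib]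
      refine Eq.trans ?_ (sum_toReal_pmf μ)
      refine Finset.sum_congr rfl fun x _ => ?_
      rcases Int.units_eq_one_or (f x) with h | h <;>
        simp [h, show (1 : ℤˣ) ≠ -1 by decide, show (-1 : ℤˣ) ≠ 1 by decide]
    linarith

end AvgDepth

/-! ### The direct sum theorem: choice of parameters. -/

theorem exp_neg_half_le {h : ℝ} (h0 : 0 ≤ h) (h1 : h ≤ 1) : Real.exp (-(h / 2)) ≤ 1 - h / 4 := by
  rw [Real.exp_neg]
  refine (inv_anti₀ (by linarith) (Real.add_one_le_exp (h / 2))).trans ?_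
  rw [inv_le_iff_one_le_mul₀ (by linarith)]
  nlinarith

/-- A random tree that computes the direct product better than guessing makes many queries. -/
theorem le_expectedDepth_directProduct {n k : ℕ} (f : (Fin n → ℤˣ) → ℤˣ) (μ : PMF (Fin n → ℤˣ))
    (hk : 0 < k) {γ δ d : ℝ} (hγ0 : 0 < γ) (hγ1 : γ < 1) (hδ0 : 0 < δ) (hδ1 : δ < 1) (hd : 0 < d)
    {t : ℕ} (ht : (1 - (γ / 8) ^ 2 / 2) ^ t ≤ δ / 2)
    (hdepth : t * ENNReal.ofReal d < avgDepth μ f δ)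
    (R : RandomizedTree (Fin k × Fin n) (Fin k → ℤˣ))
    (hR : (RandomizedTree.error (productPMF μ k) (directProduct f k) R).toReal ≤
      1 - Real.exp (-(1 / 16 * (δ * (k : ℝ)))) - γ) :
    ENNReal.ofReal (k * d) ≤ RandomizedTree.expectedDepth (productPMF μ k) R := by
  obtain ⟨H, ⟨hH, hHs⟩, hard⟩ := exists_hardcore f μ (s := δ / 2) (g := γ / 8) (by linarith)
    (by linarith) (by linarith) (by linarith) hd ht (by rwa [mul_div_cancel₀ δ two_ne_zero])
  have hk' : (0 : ℝ) < k := Nat.cast_pos.2 hk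
  set e := Real.exp (-(1 / 16 * (δ * (k : ℝ)))) with he
  -- With `H` of density `δ / 2`, the moment is at most `exp (-δ / 8)` per block; half of this decay
  -- pays for `exp (θ / 2) = exp (δ * k / 16)`.
  have hexp : Real.exp (δ / 2 * k / 4 / 2) *
      (∑ x, (μ x).toReal * Real.exp (-(H x / 2))) ^ k ≤ e := by
    have h1 : ∑ x, (μ x).toReal * Real.exp (-(H x / 2)) ≤ Real.exp (-(δ / 8)) := by
      calc _ ≤ ∑ x, ((μ x).toReal - (μ x).toReal * H x / 4) :=
            Finset.sum_le_sum fun x _ => by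
              have := mul_le_mul_of_nonneg_left (exp_neg_half_le (hH x).1 (hH x).2)
                (ENNReal.toReal_nonneg (a := μ x))
              linarith
        _ = 1 - δ / 8 := by
              rw [Finset.sum_sub_distrib, ← Finset.sum_div, hHs, sum_toReal_pmf]; ring
        _ ≤ _ := by linarith [Real.add_one_le_exp (-(δ / 8))]
    calc _ ≤ Real.exp (δ / 2 * k / 4 / 2) * Real.exp (-(δ / 8)) ^ k := by
          gcongr
      _ = e := by
          rw [← Real.exp_nat_mul, ← Real.exp_add, he]
          congr 1
          ring
  -- Error and expected depth enter linearly, so the bound for one tree can be averaged over `R`. It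
  -- is stated in `ℝ≥0∞` because the average depth may be infinite.
  have hT (T : DecisionTree (Fin k × Fin n) (Fin k → ℤˣ)) :
      1 ≤ T.error (productPMF μ k) (directProduct f k) + (ENNReal.ofReal (γ / 2 + e) +
        ENNReal.ofReal (γ / (2 * (k * d))) * T.expectedDepth (productPMF μ k)) := by
    have h := accuracy_le (fun x => ENNReal.toReal_nonneg) (sum_toReal_pmf μ) f H
      (fun x => (hH x).2) (θ := δ / 2 * k / 4) (by positivity) hard T
    simp only [← productPMF_toReal] at h
    have hsum : ∑ X, (productPMF μ k X).toReal *
          (if T.eval X = directProduct f k X then (0 : ℝ) else 1) +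
        ∑ X, (productPMF μ k X).toReal *
          (if T.eval X = directProduct f k X then (1 : ℝ) else 0) = 1 := by
      rw [← Finset.sum_add_distrib]
      refine Eq.trans ?_ (sum_toReal_pmf (productPMF μ k))
      exact Finset.sum_congr rfl fun X _ => by split_ifs <;> simp
    rw [error_eq_ofReal, expectedDepth_eq_ofReal, ← ENNReal.ofReal_mul (by positivity),
      ← ENNReal.ofReal_add (by positivity) (by positivity),
      ← ENNReal.ofReal_add (Finset.sum_nonneg fun X _ => by positivity) (by positivity)]
    refine ENNReal.one_le_ofReal.2 ?_
    set q := ∑ X, (productPMF μ k X).toReal * (T.queries X : ℝ)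
    have h2 : (δ / 2 * k / 4)⁻¹ * (k * (γ / 8 * (δ / 2)) + γ / 8 * (δ / 2) / d * q) =
        γ / 2 + γ / (2 * (k * d)) * q := by
      field_simp
      ring
    rw [h2] at h
    linarith
  have hmean : 1 ≤ RandomizedTree.error (productPMF μ k) (directProduct f k) R +
      (ENNReal.ofReal (γ / 2 + e) +
        ENNReal.ofReal (γ / (2 * (k * d))) * RandomizedTree.expectedDepth (productPMF μ k) R) := by
    have h := mean_mono R hT
    rwa [mean_const, mean_add, mean_add, mean_const, mean_const_mul] at h
  by_cases htop : RandomizedTree.expectedDepth (productPMF μ k) R = ⊤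
  · rw [htop]; exact le_top
  have herr : RandomizedTree.error (productPMF μ k) (directProduct f k) R ≠ ⊤ :=
    ne_top_of_le_ne_top ENNReal.one_ne_top (RandomizedTree.error_le_one _ _ R)
  rw [← ENNReal.ofReal_toReal htop, ← ENNReal.ofReal_toReal herr,
    ← ENNReal.ofReal_mul (by positivity),
    ← ENNReal.ofReal_add (by positivity) (by positivity),
    ← ENNReal.ofReal_add ENNReal.toReal_nonneg (by positivity), ENNReal.one_le_ofReal] at hmean
  rw [← ENNReal.ofReal_toReal htop]
  refine ENNReal.ofReal_le_ofReal ?_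
  set D := (RandomizedTree.expectedDepth (productPMF μ k) R).toReal
  have h3 : γ / 2 ≤ γ / (2 * (k * d)) * D := by linarith
  have h4 : γ / (2 * (k * d)) * D = γ / 2 * (D / (k * d)) := by field_simp
  rw [h4] at h3
  have h5 : 1 ≤ D / (k * d) := le_of_mul_le_mul_left (by linarith) (half_pos hγ0)
  rwa [one_le_div (by positivity)] at h5

theorem mul_avgDepth_le_directProduct {n k : ℕ} (f : (Fin n → ℤˣ) → ℤˣ) (μ : PMF (Fin n → ℤˣ))
    (hk : 0 < k) {γ δ : ℝ} (hγ0 : 0 < γ) (hγ1 : γ < 1) (hδ0 : 0 < δ) (hδ1 : δ < 1)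
    {t : ℕ} (ht0 : 0 < t) (ht : (1 - (γ / 8) ^ 2 / 2) ^ t ≤ δ / 2) :
    ENNReal.ofReal (k / t) * avgDepth μ f δ ≤
      avgDepth (productPMF μ k) (directProduct f k)
        (1 - Real.exp (-(1 / 16 * (δ * (k : ℝ)))) - γ) := by
  -- The hardcore theorem needs a finite `d` with `t * d` strictly below the minimum depth, so each
  -- finite `r` below the left side is treated with `d = r / k`.
  refine le_iInf₂ fun R hR => ENNReal.le_of_forall_nnreal_lt fun r hr => ?_
  rcases eq_or_ne r 0 with rfl | hr0
  · simp
  have hr0' : (0 : ℝ) < r := NNReal.coe_pos.2 (pos_iff_ne_zero.2 hr0)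
  have hk' : (0 : ℝ) < k := Nat.cast_pos.2 hk
  have ht' : (0 : ℝ) < t := Nat.cast_pos.2 ht0
  have hdepth : t * ENNReal.ofReal (r / k) < avgDepth μ f δ := by
    by_contra! h
    have h1 : ENNReal.ofReal (k / t) * avgDepth μ f δ ≤ r := by
      calc _ ≤ ENNReal.ofReal (k / t) * (t * ENNReal.ofReal (r / k)) := by gcongr
        _ = r := by
            rw [← ENNReal.ofReal_natCast t, ← ENNReal.ofReal_mul ht'.le,
              ← ENNReal.ofReal_mul (by positivity)]
            have : (k : ℝ) / t * (t * (r / k)) = r := by field_simp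
            rw [this, ENNReal.ofReal_coe_nnreal]
    exact absurd hr (not_lt.2 h1)
  have h := le_expectedDepth_directProduct f μ hk hγ0 hγ1 hδ0 hδ1 (div_pos hr0' hk') ht hdepth R hR
  rwa [mul_div_cancel₀ _ hk'.ne', ENNReal.ofReal_coe_nnreal] at h

/-- Since `(γ / 8) ^ 2 / 2 = γ ^ 2 / 128`, taking `256 * L / γ ^ 2` votes gives `exp (-2 * L) = δ ^
2 ≤ δ / 2`. Rounding up costs at most `44 * L / γ ^ 2`, because `L ≥ log 2 > 1 / 2`; hence 300. -/
theorem exists_vote_number {γ δ : ℝ} (hγ0 : 0 < γ) (hγ1 : γ < 1) (hδ0 : 0 < δ) (hδ1 : δ < 1 / 2) :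
    ∃ t : ℕ, 0 < t ∧ (1 - (γ / 8) ^ 2 / 2) ^ t ≤ δ / 2 ∧
      1 / 300 * (γ ^ 2 / Real.log (1 / δ)) ≤ 1 / t := by
  set L := Real.log (1 / δ) with hL
  have hL2 : Real.log 2 ≤ L :=
    Real.log_le_log two_pos (by rw [le_div_iff₀ hδ0]; linarith)
  have hlog2 : 1 / 2 < Real.log 2 := by linarith [Real.log_two_gt_d9]
  have hL0 : 0 < L := by linarith
  have hγ2 : 0 < γ ^ 2 := by positivity
  have hγ21 : γ ^ 2 ≤ 1 := pow_le_one₀ hγ0.le hγ1.le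
  set y := 256 * L / γ ^ 2 with hy
  have hy0 : 0 < y := by positivity
  refine ⟨⌈y⌉₊, Nat.ceil_pos.2 hy0, ?_, ?_⟩
  · have h0 : 0 ≤ 1 - (γ / 8) ^ 2 / 2 := by nlinarith
    calc _ ≤ Real.exp (-((γ / 8) ^ 2 / 2)) ^ ⌈y⌉₊ := by
          refine pow_le_pow_left₀ h0 ?_ _
          linarith [Real.add_one_le_exp (-((γ / 8) ^ 2 / 2))]
      _ = Real.exp (-(⌈y⌉₊ * ((γ / 8) ^ 2 / 2))) := by
          rw [← Real.exp_nat_mul]; ring_nf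
      _ ≤ Real.exp (-(y * ((γ / 8) ^ 2 / 2))) := by
          refine Real.exp_le_exp.2 (neg_le_neg ?_)
          gcongr
          exact Nat.le_ceil y
      _ = Real.exp (-(L + L)) := by
          congr 2
          rw [hy]
          field_simp
          ring
      _ ≤ Real.exp (-(L + Real.log 2)) := Real.exp_le_exp.2 (by linarith)
      _ = δ / 2 := by
          rw [hL, one_div, Real.log_inv, neg_add, neg_neg, Real.exp_add, Real.exp_log hδ0,
            Real.exp_neg, Real.exp_log two_pos]
          rfl
  · have hceil : (⌈y⌉₊ : ℝ) ≤ 300 * L / γ ^ 2 := by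
      have h1 := (Nat.ceil_lt_add_one hy0.le).le
      have h2 : 1 ≤ 44 * L / γ ^ 2 := by rw [le_div_iff₀ hγ2]; linarith
      calc _ ≤ y + 1 := h1
        _ ≤ y + 44 * L / γ ^ 2 := by linarith
        _ = _ := by rw [hy]; ring
    calc _ = 1 / (300 * L / γ ^ 2) := by field_simp
      _ ≤ _ := one_div_le_one_div_of_le (Nat.cast_pos.2 (Nat.ceil_pos.2 hy0)) hceil

theorem strong_direct_sum {n : ℕ} (f : (Fin n → ℤˣ) → ℤˣ) (μ : PMF (Fin n → ℤˣ)) (k : ℕ)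
    {γ δ : ℝ} (hγ0 : 0 < γ) (hγ1 : γ < 1) (hδ0 : 0 < δ) (hδ1 : δ < 1) :
    ENNReal.ofReal (1 / 300 * (γ ^ 2 * (k : ℝ) / Real.log (1 / δ))) * avgDepth μ f δ ≤
      avgDepth (productPMF μ k) (directProduct f k)
        (1 - Real.exp (-(1 / 16 * (δ * (k : ℝ)))) - γ) := by
  rcases le_or_gt (1 / 2) δ with hδ | hδ
  -- For `δ ≥ 1 / 2` a constant suffices, which disposes of the range where `log (1 / δ)` approaches
  -- 0.
  · rw [avgDepth_eq_zero μ f hδ, mul_zero]; exact zero_le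
  rcases Nat.eq_zero_or_pos k with rfl | hk
  · simp
  obtain ⟨t, ht0, ht, htc⟩ := exists_vote_number hγ0 hγ1 hδ0 hδ
  refine le_trans ?_ (mul_avgDepth_le_directProduct f μ hk hγ0 hγ1 hδ0 hδ1 ht0 ht)
  refine mul_le_mul' (ENNReal.ofReal_le_ofReal ?_) le_rfl
  calc _ = k * (1 / 300 * (γ ^ 2 / Real.log (1 / δ))) := by ring
    _ ≤ k * (1 / t) := by gcongr
    _ = _ := by ring

theorem strong_direct_sum_small_error {ε₀ : ℝ} (h0 : 0 < ε₀) (h1 : ε₀ < 1) :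
    ∃ C : ℝ, 0 < C ∧ ∃ c : ℝ, 0 < c ∧
      ∀ (n : ℕ) (f : (Fin n → ℤˣ) → ℤˣ) (μ : PMF (Fin n → ℤˣ)) (k : ℕ) (ε : ℝ),
        1 ≤ k → 0 < ε → ε ≤ ε₀ →
        ENNReal.ofReal (c * (ε ^ 2 * (k : ℝ) / Real.log (2 * (k : ℝ) / ε))) *
            avgDepth μ f (C * (ε / (k : ℝ))) ≤
          avgDepth (productPMF μ k) (directProduct f k) ε := by
  -- With `γ = b * ε` and `δ = 16 * a * ε / k`, the goal is `(1 + b) * ε ≤ 1 - exp (-a * ε)`. The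
  -- value of `b` makes `(1 + b) * ε₀ = (1 + ε₀) / 2 < 1`. By `exp (-u) ≤ 1 / (1 + u)` it is enough
  -- that `1 + b ≤ a * (1 - (1 + b) * ε)`, and `a` is chosen to give equality at `ε = ε₀`.
  set b := (1 - ε₀) / (2 * ε₀) with hb
  set a := (1 + b) * 2 / (1 - ε₀) with ha
  have h1' : 0 < 1 - ε₀ := by linarith
  have hb0 : 0 < b := by positivity
  have ha0 : 0 < a := by positivity
  have hbε : b * ε₀ = (1 - ε₀) / 2 := by rw [hb]; field_simp
  have haε : a * (1 - ε₀) = (1 + b) * 2 := by rw [ha]; field_simp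
  have ha1 : 1 ≤ 16 * a := by nlinarith
  refine ⟨16 * a, by positivity, 1 / 300 * b ^ 2, by positivity, ?_⟩
  intro n f μ k ε hk hε0 hε
  have hk' : (0 : ℝ) < k := Nat.cast_pos.2 hk
  rcases le_or_gt (1 / 2) (16 * a * (ε / k)) with hδ | hδ
  · rw [avgDepth_eq_zero μ f hδ, mul_zero]; exact zero_le
  have hδ0 : 0 < 16 * a * (ε / k) := by positivity
  have hγ1 : b * ε < 1 := by
    have := mul_le_mul_of_nonneg_left hε hb0.le
    linarith
  have hmain := strong_direct_sum f μ k (γ := b * ε) (by positivity) hγ1 hδ0 (by linarith)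
  have herr : ε ≤ 1 - Real.exp (-(1 / 16 * (16 * a * (ε / k) * (k : ℝ)))) - b * ε := by
    have h2 : 1 / 16 * (16 * a * (ε / k) * (k : ℝ)) = a * ε := by field_simp
    rw [h2, Real.exp_neg]
    have h3 : (Real.exp (a * ε))⁻¹ ≤ (a * ε + 1)⁻¹ :=
      inv_anti₀ (by positivity) (Real.add_one_le_exp _)
    have h4 : (a * ε + 1)⁻¹ ≤ 1 - (1 + b) * ε := by
      rw [inv_le_iff_one_le_mul₀ (by positivity)]
      have h5 : (1 + b) * (a * ε) ≤ (1 + b) * (a * ε₀) := by gcongr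
      have h6 : (1 + b) * (a * ε₀) = a * (1 + ε₀) / 2 := by linear_combination a * hbε
      have h7 : 0 ≤ ε * (a - (1 + b) - (1 + b) * (a * ε)) := by
        refine mul_nonneg hε0.le ?_
        linarith
      linarith
    linarith
  refine le_trans ?_ (hmain.trans (avgDepth_anti _ _ herr))
  refine mul_le_mul' (ENNReal.ofReal_le_ofReal ?_) le_rfl
  have hlog0 : 0 < Real.log (1 / (16 * a * (ε / k))) :=
    Real.log_pos (by rw [lt_div_iff₀ hδ0]; linarith)
  have hlog : Real.log (1 / (16 * a * (ε / k))) ≤ Real.log (2 * k / ε) := by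
    refine Real.log_le_log (by positivity) ?_
    rw [div_le_iff₀ hδ0]
    have h8 : 2 * (k : ℝ) / ε * (16 * a * (ε / k)) = 2 * (16 * a) := by field_simp
    rw [h8]; linarith
  calc _ = 1 / 300 * ((b * ε) ^ 2 * k / Real.log (2 * k / ε)) := by ring
    _ ≤ _ := by gcongr

end QueryComplexity

end

theorem mainTheorem1 :
    (∃ c₁ : ℝ, 0 < c₁ ∧ ∃ c₂ : ℝ, 0 < c₂ ∧
      ∀ (n : ℕ) (f : (Fin n → ℤˣ) → ℤˣ) (μ : PMF (Fin n → ℤˣ)) (k : ℕ) (γ δ : ℝ),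
        0 < γ → γ < 1 → 0 < δ → δ < 1 →
        ENNReal.ofReal (c₂ * (γ ^ 2 * (k : ℝ) / Real.log (1 / δ))) *
            QueryComplexity.avgDepth μ f δ ≤
          QueryComplexity.avgDepth (QueryComplexity.productPMF μ k)
            (QueryComplexity.directProduct f k) (1 - Real.exp (-(c₁ * (δ * (k : ℝ)))) - γ)) ∧
    (∀ ε₀ : ℝ, 0 < ε₀ → ε₀ < 1 → ∃ C : ℝ, 0 < C ∧ ∃ c : ℝ, 0 < c ∧
      ∀ (n : ℕ) (f : (Fin n → ℤˣ) → ℤˣ) (μ : PMF (Fin n → ℤˣ)) (k : ℕ) (ε : ℝ),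
        1 ≤ k → 0 < ε → ε ≤ ε₀ →
        ENNReal.ofReal (c * (ε ^ 2 * (k : ℝ) / Real.log (2 * (k : ℝ) / ε))) *
            QueryComplexity.avgDepth μ f (C * (ε / (k : ℝ))) ≤
          QueryComplexity.avgDepth (QueryComplexity.productPMF μ k)
            (QueryComplexity.directProduct f k) ε) := by
  refine ⟨⟨1 / 16, by norm_num, 1 / 300, by norm_num, ?_⟩, ?_⟩
  · intro n f μ k γ δ hγ0 hγ1 hδ0 hδ1
    exact QueryComplexity.strong_direct_sum f μ k hγ0 hγ1 hδ0 hδ1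
  · intro ε₀ h0 h1
    exact QueryComplexity.strong_direct_sum_small_error h0 h1
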